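/- For $n\ge 1$, consider undirected graphs $G$ on $V=\{1,\dots,n\}$ without self-loops and with nonnegative edge weights $w_G(u,v)$ (weight $0$ meaning no edge). A hierarchical clustering is a rooted tree $T$ with leaf set $V$; its Dasgupta cost is $\omega_G(T)=\sum_{(u,v)\in V^2} w_G(u,v)\,|\mathrm{leaves}(T[u\wedge v])|$, where $T[u\wedge v]$ is the smallest subtree containing $u$ and $v$, and $\omega_G^*=\min_T\omega_G(T)$. A randomized clustering algorithm $\mathcal A$ is an $(a,b)$-approximation on $n$ vertices if $\mathbb E[\omega_G(\mathcal A(G))]\le a\,\omega_G^*+b$ for all such $G$. Graphs $G,G'$ are adjacent if $\sum_{u,v\in V}|w_G(u,v)-w_{G'}(u,v)|\le 1$, and a randomized map $\mathcal M$ is $(\varepsilon,\delta)$-edge-DP if $\Pr[\mathcal M(G')\in S]\le e^{\varepsilon}\Pr[\mathcal M(G)\in S]+\delta$ for all adjacent $G,G'$ and all sets $S$ of outputs. A graph $G'$ is an $(\alpha,\beta)$-approximation to cut queries in $G$ if for all $S\subseteq V$ $$(1-\alpha)w_G(S,\overline S)-\beta\min\{|S|,n-|S|\}\le w_{G'}(S,\overline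 S)\le(1+\alpha)w_G(S,\overline S)+\beta\min\{|S|,n-|S|\}.$$ **Theorem.** There are an absolute constant $C>0$ and a sequence $\eta_n\to 0$ such that for all $n\ge1$, $\varepsilon>0$ and $0<\delta<1$ there is an $(\varepsilon,\delta)$-edge-DP randomized map $\mathcal M$, which on input an $n$-vertex graph $G$ outputs a synthetic $n$-vertex graph $G'$, with the following properties. 1. For every $G$, with probability at least $0.8$ the graph $G'=\mathcal M(G)$ is a $(z,nz)$-approximation to cut queries in $G$, where $z=C\,\frac{\log^2(1/\delta)}{\varepsilon}\,\frac{\log n}{\sqrt n}$. 2. Let $\mathcal A$ be any (non-private, possibly randomized) $(a_n,0)$-approximation algorithm for the Dasgupta cost on $n$ vertices. Then running $\mathcal A$ with fresh coins on $G'=\mathcal M(G)$ is an $(\varepsilon,\delta)$-edge-DP algorithm, and for every $G$, with probability at least $0.8$ over the draw of $G'$, $$\mathbb E\big[\omega_G(\mathcal A(G'))\,\big|\,G'\big]\le(1+\eta_n)\,a_n\,\omega_G^*+C\,(a_n+\log n)\,\frac{n^{2.5}\log n\,\log^2(1/\delta)}{\varepsilon}.$$ In particular, if $a_n=O(\log n)$,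 the additive error is $O\big(n^{2.5}\log^2 n\,\log^2(1/\delta)/\varepsilon\big)$. 3. For an arbitrary $a_n$ for which an $(a_n,0)$-approximation $\mathcal A$ exists, there is a randomized post-processing $\mathcal K$ of the graph $G'$ (sending graphs to trees) such that $\mathcal K\circ\mathcal M$ is $(\varepsilon,\delta)$-edge-DP and, for every $G$, with probability at least $0.8$ over the draw of $G'$, $$\mathbb E\big[\omega_G(\mathcal K(G'))\,\big|\,G'\big]\le(1+\eta_n)\,a_n\,\omega_G^*+C\,\frac{n^{2.5}\log^2 n\,\log^2(1/\delta)}{\varepsilon};$$ that is, with probability at least $0.8$ it is a $\big((1+o(1))a_n,\;O(n^{2.5}\log^2n\,\log^2(1/\delta)/\varepsilon)\big)$-approximation algorithm. -/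

import Mathlib

open Filter Topology

namespace HC

/-- An undirected graph on the vertex set `Fin n` with nonnegative edge weights;
`w u v = 0` means that `u` and `v` are not joined by an edge. There are no self-loops. -/
structure WGraph (n : ℕ) where
  w : Fin n → Fin n → ℝ
  symm : ∀ u v, w u v = w v u
  nonneg : ∀ u v, 0 ≤ w u v
  loopless : ∀ u, w u u = 0

/-- A hierarchical clustering of `Fin n`, i.e. a rooted tree (binary or not) whose leaves are the
elements of `Fin n`. It is given by the collection of the leaf sets of its subtrees: the whole
vertex set (the root), all singletons (the leaves), any two members being nested or disjoint. -/
structure HCTree (n : ℕ) where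
  clusters : Finset (Finset (Fin n))
  root_mem : Finset.univ ∈ clusters
  leaf_mem : ∀ v, {v} ∈ clusters
  nonempty_of_mem : ∀ S ∈ clusters, S.Nonempty
  laminar : ∀ S ∈ clusters, ∀ R ∈ clusters, S ⊆ R ∨ R ⊆ S ∨ Disjoint S R

theorem HCTree.clusters_injective (n : ℕ) :
    Function.Injective (HCTree.clusters : HCTree n → Finset (Finset (Fin n))) := by
  intro S T h
  cases S
  cases T
  simpa using h

noncomputable instance (n : ℕ) : Fintype (HCTree n) :=
  Fintype.ofInjective _ (HCTree.clusters_injective n)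

/-- The number of leaves of the smallest subtree of `T` that contains both `u` and `v`. -/
noncomputable def HCTree.lcaSize {n : ℕ} (T : HCTree n) (u v : Fin n) : ℕ :=
  sInf {k | ∃ S ∈ T.clusters, u ∈ S ∧ v ∈ S ∧ S.card = k}

/-- Dasgupta's cost of the tree `T` on the graph `G` (a sum over ordered pairs). -/
noncomputable def cost {n : ℕ} (G : WGraph n) (T : HCTree n) : ℝ :=
  ∑ u, ∑ v, G.w u v * (T.lcaSize u v : ℝ)

/-- The optimal Dasgupta cost of `G` (for `1 ≤ n`, a minimum over a finite nonempty set). -/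
noncomputable def optCost {n : ℕ} (G : WGraph n) : ℝ :=
  ⨅ T : HCTree n, cost G T

/-- Adjacent graphs: the weight matrices have `L₁`-distance at most one. -/
def Adjacent {n : ℕ} (G G' : WGraph n) : Prop :=
  ∑ u, ∑ v, |G.w u v - G'.w u v| ≤ 1

/-- The probability of the event `s` under the distribution `p`. -/
noncomputable def prob {Y : Type*} (p : PMF Y) (s : Set Y) : ℝ :=
  (p.toOuterMeasure s).toReal

/-- `(ε, δ)`-edge differential privacy of a randomized map on weighted graphs. -/
def IsEdgeDP {n : ℕ} {Y : Type*} (ε δ : ℝ) (M : WGraph n → PMF Y) : Prop :=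
  ∀ G G' : WGraph n, Adjacent G G' →
    ∀ s : Set Y, prob (M G') s ≤ Real.exp ε * prob (M G) s + δ

/-- The expected cost on `G` of a random tree with distribution `p`. -/
noncomputable def expCost {n : ℕ} (G : WGraph n) (p : PMF (HCTree n)) : ℝ :=
  ∑ T, (p T).toReal * cost G T

/-- The randomized clustering algorithm `A` (on `n` vertices) is an `(a, b)`-approximation. -/
def IsApprox {n : ℕ} (a b : ℝ) (A : WGraph n → PMF (HCTree n)) : Prop :=
  ∀ G : WGraph n, expCost G (A G) ≤ a * optCost G + b

/-- The algorithm that first draws `G'` from `M G` and then, with fresh coins, a tree from `K G'`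
is with probability at least `p` an `(a, b)`-approximation: with probability at least `p` over the
draw of `G'`, the expectation of the cost on `G` over the coins of `K` is at most
`a * optCost G + b`. -/
def IsApproxWithProb {n : ℕ} (p a b : ℝ) (M : WGraph n → PMF (WGraph n))
    (K : WGraph n → PMF (HCTree n)) : Prop :=
  ∀ G : WGraph n, p ≤ prob (M G) {G' | expCost G (K G') ≤ a * optCost G + b}

/-- The weight `w(S, Sᶜ)` of the cut `(S, Sᶜ)`. -/
noncomputable def cut {n : ℕ} (G : WGraph n) (S : Finset (Fin n)) : ℝ :=
  ∑ u ∈ S, ∑ v ∈ Sᶜ, G.w u v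

/-- `G'` is an `(α, β)`-approximation to cut queries in `G`. -/
def IsCutApprox {n : ℕ} (α β : ℝ) (G G' : WGraph n) : Prop :=
  ∀ S : Finset (Fin n),
    (1 - α) * cut G S - β * min (S.card : ℝ) ((n : ℝ) - S.card) ≤ cut G' S ∧
      cut G' S ≤ (1 + α) * cut G S + β * min (S.card : ℝ) ((n : ℝ) - S.card)

/-- The accuracy parameter `C · log²(1/δ) / ε · log n / √n` of the released graph. -/
noncomputable def cutError (C ε δ : ℝ) (n : ℕ) : ℝ :=
  C * (Real.log (1 / δ) ^ 2 / ε) * (Real.log n / Real.sqrt n)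

end HC

namespace HC

/-! The Dasgupta cost is a sum of cuts. For each `k < n` the maximal clusters of size at most `k`,
together with the remaining singletons, partition the vertices, and a pair `u ≠ v` is separated at
exactly `lcaSize u v` of these levels. Hence the cost is the sum over levels of the cuts of all
parts (`cost_eq_sum_cut`). If each cut is known up to `β * |S|`, a level contributes error at most
`β * n`, because its parts partition the vertices, and every tree has error at most `n² β`
(`abs_cost_sub_cost_le`). It therefore suffices to release privately a graph with `β` of order `√n
log n / ε`.

For this the weights are rounded to multiples of `1 / N`, independent discrete Laplace noise is
added to every ordered pair, and some graph whose cuts fit the noisy ones is output. Integer noise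
keeps all distributions discrete, hence `PMF`s. Privacy is pure: rounded weights of adjacent graphs
are at `L₁`-distance at most `N + n²`, and fitting is post-processing. For accuracy, a Chernoff
bound for the at most `n |S|` noise terms of a cut gives failure probability at most `2 n ^ (-6
|S|)`, small enough for a union bound over all nonempty `S` (`four_fifths_le_prob_noise`).

The factor `log²(1/δ)` is bounded below when `δ < 4/5`. When `δ ≥ 4/5`, releasing the input with
probability `δ` is private and exact often enough.

Running `A` on the released graph costs an additive error proportional to `a + 1`. Using an exact
optimal tree of the released graph as post-processing removes the factor `a`. One may take `η = 0`.
-/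

/-! ### The Dasgupta cost as a sum of cuts over levels -/

theorem HCTree.lcaSize_le_iff {n : ℕ} (T : HCTree n) (u v : Fin n) (k : ℕ) :
    T.lcaSize u v ≤ k ↔ ∃ S ∈ T.clusters, u ∈ S ∧ v ∈ S ∧ S.card ≤ k := by
  have hne : {k | ∃ S ∈ T.clusters, u ∈ S ∧ v ∈ S ∧ S.card = k}.Nonempty :=
    ⟨_, Finset.univ, T.root_mem, Finset.mem_univ _, Finset.mem_univ _, rfl⟩
  constructor
  · intro h
    obtain ⟨S, hS, hu, hv, hc⟩ := Nat.sInf_mem hne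
    exact ⟨S, hS, hu, hv, hc.trans_le h⟩
  · rintro ⟨S, hS, hu, hv, hc⟩
    exact (show T.lcaSize u v ≤ S.card from Nat.sInf_le ⟨S, hS, hu, hv, rfl⟩).trans hc

theorem HCTree.lcaSize_le {n : ℕ} (T : HCTree n) (u v : Fin n) : T.lcaSize u v ≤ n :=
  (T.lcaSize_le_iff u v n).2
    ⟨Finset.univ, T.root_mem, Finset.mem_univ _, Finset.mem_univ _, by simp⟩

/-- Two leaves are related at level `k` if they are equal or lie in a common cluster of size at
most `k`. -/
def HCTree.level {n : ℕ} (T : HCTree n) (k : ℕ) : Setoid (Fin n) where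
  r u v := u = v ∨ T.lcaSize u v ≤ k
  iseqv := by
    refine ⟨fun u => Or.inl rfl, ?_, ?_⟩
    · rintro u v (h | h)
      · exact Or.inl h.symm
      · obtain ⟨S, hS, hu, hv, hc⟩ := (T.lcaSize_le_iff u v k).1 h
        exact Or.inr ((T.lcaSize_le_iff v u k).2 ⟨S, hS, hv, hu, hc⟩)
    · rintro u v x (rfl | h) (rfl | h')
      · exact Or.inl rfl
      · exact Or.inr h'
      · exact Or.inr h
      · obtain ⟨S, hS, hu, hv, hc⟩ := (T.lcaSize_le_iff _ _ k).1 h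
        obtain ⟨R, hR, hv', hx, hc'⟩ := (T.lcaSize_le_iff _ _ k).1 h'
        refine Or.inr ((T.lcaSize_le_iff _ _ k).2 ?_)
        -- Two clusters sharing `v` are nested, so the larger one contains both ends and still has
        -- size at most `k`.
        rcases T.laminar S hS R hR with hSR | hRS | hd
        · exact ⟨R, hR, hSR hu, hx, hc'⟩
        · exact ⟨S, hS, hu, hRS hx, hc⟩
        · exact absurd hv' (Finset.disjoint_left.1 hd hv)

open Classical in
/-- The equivalence class of `u`, as a finite set. -/
noncomputable def classOf {n : ℕ} (r : Setoid (Fin n)) (u : Fin n) : Finset (Fin n) :=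
  Finset.univ.filter (fun v => r u v)

theorem classOf_eq_iff {n : ℕ} (r : Setoid (Fin n)) (u v : Fin n) :
    classOf r v = classOf r u ↔ v ∈ classOf r u := by
  constructor
  · intro h
    rw [← h]
    simp [classOf]
  · intro h
    have h : r u v := by simpa [classOf] using h
    ext x
    simp only [classOf, Finset.mem_filter, Finset.mem_univ, true_and]
    exact ⟨fun hx => r.trans h hx, fun hx => r.trans (r.symm h) hx⟩

-- Grouping the ordered pairs `(u, v)` by the class of `u`, the separated pairs starting in a class
-- `S` form precisely the cut of `S`.
open Classical in
theorem sum_separated_eq_sum_cut {n : ℕ} (G : WGraph n) (r : Setoid (Fin n)) :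
    ∑ u, ∑ v, (if r u v then 0 else G.w u v) =
      ∑ S ∈ Finset.univ.image (classOf r), cut G S := by
  rw [← Finset.sum_fiberwise_of_maps_to (t := Finset.univ.image (classOf r)) (g := classOf r)
    (fun u hu => Finset.mem_image_of_mem _ hu)]
  refine Finset.sum_congr rfl fun S hS => ?_
  obtain ⟨u₀, -, rfl⟩ := Finset.mem_image.1 hS
  have hfil : Finset.univ.filter (fun u => classOf r u = classOf r u₀) = classOf r u₀ := by
    ext u
    simp [classOf_eq_iff]
  rw [hfil, cut]
  refine Finset.sum_congr rfl fun u hu => ?_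
  rw [← (classOf_eq_iff r u₀ u).2 hu]
  have hc : (classOf r u)ᶜ = Finset.univ.filter (fun v => ¬ r u v) := by
    ext v
    simp [classOf]
  rw [hc, Finset.sum_filter]
  refine Finset.sum_congr rfl fun v _ => ?_
  by_cases h : r u v <;> simp [h]

theorem sum_card_classOf {n : ℕ} (r : Setoid (Fin n)) :
    ∑ S ∈ Finset.univ.image (classOf r), S.card = n := by
  classical
  have h := Finset.card_eq_sum_card_image (classOf r) Finset.univ
  rw [Finset.card_univ, Fintype.card_fin] at h
  conv_rhs => rw [h]
  refine Finset.sum_congr rfl fun S hS => ?_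
  obtain ⟨u₀, -, rfl⟩ := Finset.mem_image.1 hS
  congr 1
  ext u
  simp [classOf_eq_iff]

-- For `u ≠ v`, level `k` separates `u` from `v` exactly when `k < lcaSize u v`, so the weight of
-- the pair is counted `lcaSize u v` times.
open Classical in
theorem cost_eq_sum_cut {n : ℕ} (G : WGraph n) (T : HCTree n) :
    cost G T =
      ∑ k ∈ Finset.range n, ∑ S ∈ Finset.univ.image (classOf (T.level k)), cut G S := by
  simp_rw [← sum_separated_eq_sum_cut]
  rw [Finset.sum_comm]
  refine Finset.sum_congr rfl fun u _ => ?_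
  rw [Finset.sum_comm]
  refine Finset.sum_congr rfl fun v _ => ?_
  by_cases huv : u = v
  · subst huv
    simp [G.loopless]
  · have h1 : ∀ k, (if (T.level k) u v then (0 : ℝ) else G.w u v) =
        if k < T.lcaSize u v then G.w u v else 0 := by
      intro k
      have : (T.level k) u v ↔ ¬ k < T.lcaSize u v := by
        change (u = v ∨ T.lcaSize u v ≤ k) ↔ _
        simp [huv]
      by_cases hk : k < T.lcaSize u v <;> simp [this, hk]
    simp_rw [h1]
    rw [← Finset.sum_filter, Finset.sum_const]
    have h2 : (Finset.range n).filter (fun k => k < T.lcaSize u v) =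
        Finset.range (T.lcaSize u v) := by
      ext k
      have := T.lcaSize_le u v
      simp only [Finset.mem_filter, Finset.mem_range]
      omega
    rw [h2, Finset.card_range, nsmul_eq_mul, mul_comm]

/-- Graphs with close cuts have close Dasgupta costs on all trees. -/
theorem abs_cost_sub_cost_le {n : ℕ} {G G' : WGraph n} {β : ℝ}
    (h : ∀ S : Finset (Fin n), |cut G S - cut G' S| ≤ β * S.card) (T : HCTree n) :
    |cost G T - cost G' T| ≤ (n : ℝ) ^ 2 * β := by
  classical
  rw [cost_eq_sum_cut, cost_eq_sum_cut, ← Finset.sum_sub_distrib]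
  refine (Finset.abs_sum_le_sum_abs _ _).trans ?_
  have hk : ∀ k ∈ Finset.range n,
      |∑ S ∈ Finset.univ.image (classOf (T.level k)), cut G S -
        ∑ S ∈ Finset.univ.image (classOf (T.level k)), cut G' S| ≤ β * n := by
    intro k _
    rw [← Finset.sum_sub_distrib]
    refine (Finset.abs_sum_le_sum_abs _ _).trans ((Finset.sum_le_sum fun S _ => h S).trans ?_)
    rw [← Finset.mul_sum, ← Nat.cast_sum, sum_card_classOf]
  refine (Finset.sum_le_sum hk).trans (le_of_eq ?_)
  simp only [Finset.sum_const, Finset.card_range, nsmul_eq_mul]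
  ring

theorem cut_compl {n : ℕ} (G : WGraph n) (S : Finset (Fin n)) : cut G Sᶜ = cut G S := by
  rw [cut, cut, compl_compl, Finset.sum_comm]
  exact Finset.sum_congr rfl fun u _ => Finset.sum_congr rfl fun v _ => G.symm _ _

theorem cut_nonneg {n : ℕ} (G : WGraph n) (S : Finset (Fin n)) : 0 ≤ cut G S :=
  Finset.sum_nonneg fun _ _ => Finset.sum_nonneg fun _ _ => G.nonneg _ _

/-- An additive cut error proportional to `|S|` is automatically proportional to
`min |S| |Sᶜ|`. -/
theorem isCutApprox_of_abs_le {n : ℕ} {G G' : WGraph n} {α β : ℝ} (hα : 0 ≤ α)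
    (h : ∀ S : Finset (Fin n), |cut G S - cut G' S| ≤ β * S.card) :
    IsCutApprox α β G G' := by
  intro S
  have h1 := abs_le.1 (h S)
  -- Cuts are symmetric, so the bound for the complement supplies the error `β * (n - |S|)`. The
  -- factor `α` is only slack.
  have h2 := abs_le.1 (h Sᶜ)
  rw [cut_compl, cut_compl, Finset.card_compl, Fintype.card_fin,
    Nat.cast_sub (by simpa using S.card_le_univ)] at h2
  have h3 := mul_nonneg hα (cut_nonneg G S)
  rcases min_cases (S.card : ℝ) ((n : ℝ) - S.card) with ⟨h, -⟩ | ⟨h, -⟩ <;> rw [h] <;>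
    constructor <;> linarith

/-! ### Optimal trees and comparison of expected costs -/

/-- The star, i.e. the tree without proper inner clusters. -/
def starTree {n : ℕ} (hn : 1 ≤ n) : HCTree n where
  clusters := insert Finset.univ (Finset.univ.image fun v => {v})
  root_mem := Finset.mem_insert_self _ _
  leaf_mem v := Finset.mem_insert_of_mem (Finset.mem_image_of_mem _ (Finset.mem_univ v))
  nonempty_of_mem := by
    intro S hS
    rcases Finset.mem_insert.1 hS with rfl | hS
    · exact ⟨⟨0, hn⟩, Finset.mem_univ _⟩
    · obtain ⟨v, -, rfl⟩ := Finset.mem_image.1 hS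
      exact Finset.singleton_nonempty v
  laminar := by
    intro S hS R hR
    rcases Finset.mem_insert.1 hR with rfl | hR
    · exact Or.inl (Finset.subset_univ _)
    rcases Finset.mem_insert.1 hS with rfl | hS
    · exact Or.inr (Or.inl (Finset.subset_univ _))
    obtain ⟨u, -, rfl⟩ := Finset.mem_image.1 hS
    obtain ⟨v, -, rfl⟩ := Finset.mem_image.1 hR
    by_cases h : u = v
    · exact Or.inl (by rw [h])
    · exact Or.inr (Or.inr (by simpa using h))

theorem optCost_le {n : ℕ} (G : WGraph n) (T : HCTree n) : optCost G ≤ cost G T :=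
  ciInf_le (Set.finite_range _).bddBelow T

theorem exists_cost_eq_optCost {n : ℕ} (hn : 1 ≤ n) (G : WGraph n) :
    ∃ T : HCTree n, cost G T = optCost G := by
  have : Nonempty (HCTree n) := ⟨starTree hn⟩
  exact exists_eq_ciInf_of_finite

theorem sum_toReal_eq_one {Y : Type*} [Fintype Y] (p : PMF Y) : ∑ y, (p y).toReal = 1 := by
  rw [← ENNReal.toReal_sum fun y _ => p.apply_ne_top y, ← tsum_fintype (L := .unconditional _), p.tsum_coe,
    ENNReal.toReal_one]

theorem le_expCost {n : ℕ} (G : WGraph n) (p : PMF (HCTree n)) : optCost G ≤ expCost G p := by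
  calc optCost G = ∑ T, (p T).toReal * optCost G := by
        rw [← Finset.sum_mul, sum_toReal_eq_one, one_mul]
    _ ≤ expCost G p := Finset.sum_le_sum fun T _ =>
        mul_le_mul_of_nonneg_left (optCost_le G T) ENNReal.toReal_nonneg

theorem expCost_le_add {n : ℕ} {G G' : WGraph n} {E : ℝ}
    (h : ∀ T, |cost G T - cost G' T| ≤ E) (p : PMF (HCTree n)) :
    expCost G p ≤ expCost G' p + E := by
  calc expCost G p ≤ ∑ T, (p T).toReal * (cost G' T + E) := Finset.sum_le_sum fun T _ =>
        mul_le_mul_of_nonneg_left (by linarith [(abs_le.1 (h T)).2]) ENNReal.toReal_nonneg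
    _ = expCost G' p + E := by
        simp_rw [mul_add]
        rw [Finset.sum_add_distrib, ← Finset.sum_mul, sum_toReal_eq_one, one_mul, expCost]

theorem optCost_le_add {n : ℕ} (hn : 1 ≤ n) {G G' : WGraph n} {E : ℝ}
    (h : ∀ T, |cost G T - cost G' T| ≤ E) : optCost G' ≤ optCost G + E := by
  obtain ⟨T, hT⟩ := exists_cost_eq_optCost hn G
  linarith [optCost_le G' T, (abs_le.1 (h T)).1]

/-- The complete graph with unit weights. -/
noncomputable def completeWGraph (n : ℕ) : WGraph n where
  w u v := if u = v then 0 else 1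
  symm u v := by simp [eq_comm]
  nonneg u v := by split_ifs <;> simp
  loopless u := by simp

theorem optCost_completeWGraph_pos {n : ℕ} (hn : 2 ≤ n) : 0 < optCost (completeWGraph n) := by
  obtain ⟨T, hT⟩ := exists_cost_eq_optCost (by omega) (completeWGraph n)
  rw [← hT]
  have hnn : ∀ u v : Fin n, 0 ≤ (completeWGraph n).w u v * (T.lcaSize u v : ℝ) := fun u v =>
    mul_nonneg ((completeWGraph n).nonneg _ _) (Nat.cast_nonneg _)
  let u : Fin n := ⟨0, by omega⟩
  let v : Fin n := ⟨1, by omega⟩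
  have huv : u ≠ v := by simp [u, v]
  refine Finset.sum_pos' (fun u _ => Finset.sum_nonneg fun v _ => hnn u v)
    ⟨u, Finset.mem_univ _, Finset.sum_pos' (fun v _ => hnn u v) ⟨v, Finset.mem_univ _, ?_⟩⟩
  refine mul_pos (by simp [completeWGraph, huv]) (Nat.cast_pos.2 (Nat.pos_of_ne_zero fun h => ?_))
  obtain ⟨S, -, hu, -, hc⟩ := (T.lcaSize_le_iff u v 0).1 h.le
  exact absurd (Finset.card_pos.2 ⟨u, hu⟩) (by omega)

/-- The complete graph has positive optimum, which no algorithm can beat. For `n ≤ 1` all costs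
vanish and `a` may be any real number. -/
theorem IsApprox.one_le {n : ℕ} (hn : 2 ≤ n) {a : ℝ} {A : WGraph n → PMF (HCTree n)}
    (hA : IsApprox a 0 A) : 1 ≤ a := by
  have h := (le_expCost _ (A (completeWGraph n))).trans (hA (completeWGraph n))
  have hp := optCost_completeWGraph_pos hn
  by_contra hlt
  nlinarith

theorem cost_eq_zero_of_le_one {n : ℕ} (hn : n ≤ 1) (G : WGraph n) (T : HCTree n) :
    cost G T = 0 := by
  refine Finset.sum_eq_zero fun u _ => Finset.sum_eq_zero fun v _ => ?_
  have : u = v := Fin.ext (by omega)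
  rw [this, G.loopless, zero_mul]

/-! ### Probabilities and post-processing of private maps -/

theorem prob_mono {Y : Type*} (p : PMF Y) {s t : Set Y} (h : s ⊆ t) : prob p s ≤ prob p t :=
  ENNReal.toReal_mono
    ((p.toOuterMeasure_apply t).trans_ne (p.tsum_coe_indicator_ne_top t)) (p.toOuterMeasure.mono h)

theorem toOuterMeasure_ne_top {Y : Type*} (p : PMF Y) (s : Set Y) : p.toOuterMeasure s ≠ ⊤ :=
  (p.toOuterMeasure_apply s).trans_ne (p.tsum_coe_indicator_ne_top s)

theorem prob_nonneg {Y : Type*} (p : PMF Y) (s : Set Y) : 0 ≤ prob p s := ENNReal.toReal_nonneg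

theorem isEdgeDP_iff {n : ℕ} {Y : Type*} {ε δ : ℝ} (hδ : 0 ≤ δ) (M : WGraph n → PMF Y) :
    IsEdgeDP ε δ M ↔ ∀ G G' : WGraph n, Adjacent G G' → ∀ s : Set Y,
      (M G').toOuterMeasure s ≤
        ENNReal.ofReal (Real.exp ε) * (M G).toOuterMeasure s + ENNReal.ofReal δ := by
  refine forall_congr' fun G => forall_congr' fun G' => forall_congr' fun _ =>
    forall_congr' fun s => ?_
  have hne := toOuterMeasure_ne_top (M G) s
  rw [prob, prob, ← ENNReal.ofReal_le_ofReal_iff (by positivity),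
    ENNReal.ofReal_add (by positivity) hδ, ENNReal.ofReal_mul (Real.exp_pos _).le,
    ENNReal.ofReal_toReal hne, ENNReal.ofReal_toReal (toOuterMeasure_ne_top _ _)]

/-- Privacy is preserved by randomized post-processing. -/
theorem IsEdgeDP.bind {n : ℕ} {X Y : Type*} {ε δ : ℝ} (hδ : 0 ≤ δ) {M : WGraph n → PMF X}
    (hM : IsEdgeDP ε δ M) (K : X → PMF Y) : IsEdgeDP ε δ (fun G => (M G).bind K) := by
  rw [isEdgeDP_iff hδ] at hM ⊢
  intro G G' hG s
  set c := ENNReal.ofReal (Real.exp ε)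
  have hc : c ≠ ⊤ := ENNReal.ofReal_ne_top
  -- The worst event for the privacy inequality: for any weight `0 ≤ f ≤ 1`, the sum of `(M G' - c *
  -- M G) * f` is at most the sum of `M G' - c * M G` over `S`, which is at most `δ`. The inequality
  -- is kept in additive form to avoid truncated subtraction.
  let S : Set X := {x | c * M G x ≤ M G' x}
  have hS := hM G G' hG S
  simp only [PMF.toOuterMeasure_bind_apply]
  have hf : ∀ x, (K x).toOuterMeasure s ≤ 1 := fun x =>
    ((K x).toOuterMeasure.mono (Set.subset_univ s)).trans_eq
      (((K x).toOuterMeasure_apply_eq_one_iff _).2 (Set.subset_univ _))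
  have hpt : ∀ x, M G' x * (K x).toOuterMeasure s + c * S.indicator (M G) x ≤
      c * (M G x * (K x).toOuterMeasure s) + S.indicator (M G') x := by
    intro x
    by_cases hx : x ∈ S
    · have hx' : c * M G x ≤ M G' x := hx
      rw [Set.indicator_of_mem hx, Set.indicator_of_mem hx]
      have key : ∀ a b f : ENNReal, a ≤ b → f ≤ 1 → b * f + a ≤ a * f + b := by
        intro a b f hab hf1
        obtain ⟨d, rfl⟩ := exists_add_of_le hab
        calc (a + d) * f + a = a * f + a + d * f := by ring
          _ ≤ a * f + a + d * 1 := by gcongr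
          _ = a * f + (a + d) := by ring
      calc _ ≤ (c * M G x) * (K x).toOuterMeasure s + M G' x := key _ _ _ hx' (hf x)
        _ = _ := by ring
    · have hx' : M G' x ≤ c * M G x := (not_le.1 hx).le
      rw [Set.indicator_of_notMem hx, Set.indicator_of_notMem hx, mul_zero, add_zero, add_zero,
        ← mul_assoc]
      gcongr
  have hsum := ENNReal.tsum_le_tsum hpt
  rw [ENNReal.tsum_add, ENNReal.tsum_add, ENNReal.tsum_mul_left, ENNReal.tsum_mul_left,
    ← PMF.toOuterMeasure_apply, ← PMF.toOuterMeasure_apply] at hsum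
  have hfin : c * (M G).toOuterMeasure S ≠ ⊤ :=
    ENNReal.mul_ne_top hc (toOuterMeasure_ne_top _ _)
  refine (ENNReal.add_le_add_iff_right hfin).1 (hsum.trans ?_)
  calc _ ≤ c * ∑' x, M G x * (K x).toOuterMeasure s +
        (c * (M G).toOuterMeasure S + ENNReal.ofReal δ) := by gcongr
    _ = _ := by ring

theorem le_prob_of_compl_le {Y : Type*} (p : PMF Y) (s : Set Y) {r : ℝ}
    (h : prob p sᶜ ≤ r) : 1 - r ≤ prob p s := by
  have h1 : p.toOuterMeasure s + p.toOuterMeasure sᶜ = 1 := by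
    rw [PMF.toOuterMeasure_apply, PMF.toOuterMeasure_apply, ← ENNReal.tsum_add]
    exact (tsum_congr fun x => Set.indicator_self_add_compl_apply s p x).trans p.tsum_coe
  have h2 := congrArg ENNReal.toReal h1
  rw [ENNReal.toReal_add (toOuterMeasure_ne_top _ _) (toOuterMeasure_ne_top _ _),
    ENNReal.toReal_one] at h2
  change prob p s + prob p sᶜ = 1 at h2
  linarith

/-! ### The mechanism for large `δ` -/

/-- Releasing the input with probability `δ`, and nothing otherwise. -/
noncomputable def releaseOrHide {n : ℕ} (G₀ : WGraph n) (δ : NNReal) (hδ : δ ≤ 1)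
    (G : WGraph n) : PMF (WGraph n) :=
  (PMF.ofFintype (fun b : Bool => if b then (δ : ENNReal) else (1 - δ : NNReal))
    (by simp [hδ])).bind fun b => PMF.pure (if b then G else G₀)

theorem toOuterMeasure_releaseOrHide {n : ℕ} (G₀ : WGraph n) (δ : NNReal) (hδ : δ ≤ 1)
    (G : WGraph n) (s : Set (WGraph n)) :
    (releaseOrHide G₀ δ hδ G).toOuterMeasure s =
      δ * s.indicator 1 G + (1 - δ : NNReal) * s.indicator 1 G₀ := by
  classical
  simp only [releaseOrHide, PMF.toOuterMeasure_bind_apply, tsum_fintype, Fintype.sum_bool,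
    PMF.ofFintype_apply, PMF.toOuterMeasure_pure_apply, Set.indicator_apply]
  simp

/-- Only a part of mass `δ` of the output law depends on the input. -/
theorem isEdgeDP_releaseOrHide {n : ℕ} (G₀ : WGraph n) (δ : NNReal) (hδ : δ ≤ 1) {ε : ℝ}
    (hε : 0 ≤ ε) : IsEdgeDP ε δ (releaseOrHide G₀ δ hδ) := by
  rw [isEdgeDP_iff (NNReal.coe_nonneg δ)]
  intro G G' _ s
  simp only [toOuterMeasure_releaseOrHide, ENNReal.ofReal_coe_nnreal]
  have h1 : (1 : ENNReal) ≤ ENNReal.ofReal (Real.exp ε) := by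
    rw [← ENNReal.ofReal_one]
    exact ENNReal.ofReal_le_ofReal (Real.one_le_exp hε)
  have h2 : s.indicator (1 : WGraph n → ENNReal) G' ≤ 1 :=
    Set.indicator_le_self' (fun _ _ => zero_le) _
  calc _ ≤ (δ : ENNReal) * 1 + 1 * ((1 - δ : NNReal) * s.indicator 1 G₀) := by
        rw [one_mul]; gcongr
    _ ≤ (δ : ENNReal) * 1 + ENNReal.ofReal (Real.exp ε) *
          (δ * s.indicator 1 G + (1 - δ : NNReal) * s.indicator 1 G₀) := by
        gcongr; exact le_add_self
    _ = _ := by rw [mul_one, add_comm]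

theorem le_prob_releaseOrHide {n : ℕ} (G₀ : WGraph n) (δ : NNReal) (hδ : δ ≤ 1)
    (G : WGraph n) {s : Set (WGraph n)} (hs : G ∈ s) :
    (δ : ℝ) ≤ prob (releaseOrHide G₀ δ hδ G) s := by
  have h : (δ : ENNReal) ≤ (releaseOrHide G₀ δ hδ G).toOuterMeasure s := by
    rw [toOuterMeasure_releaseOrHide, Set.indicator_of_mem hs, Pi.one_apply, mul_one]
    exact le_self_add
  exact ENNReal.toReal_mono (toOuterMeasure_ne_top _ _) h

/-! ### Discrete Laplace noise: moment generating function and tails -/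

/-- Compare power series termwise: every remaining power of `θ` is even and at least the second. -/
theorem cosh_mul_sub_one_le (θ x : ℝ) (hθ : |θ| ≤ 1) :
    Real.cosh (θ * x) - 1 ≤ θ ^ 2 * (Real.cosh x - 1) := by
  have h : ∀ y : ℝ, HasSum (fun k : ℕ => y ^ (2 * (k + 1)) / ((2 * (k + 1)).factorial : ℝ))
      (Real.cosh y - 1) := by
    intro y
    have := (hasSum_nat_add_iff' 1).2 (Real.hasSum_cosh y)
    simpa using this
  refine hasSum_le (fun k => ?_) (h (θ * x)) ((h x).mul_left (θ ^ 2))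
  have h1 : θ ^ 2 ≤ 1 := (sq_le_one_iff_abs_le_one θ).2 hθ
  rw [← mul_div_assoc]
  refine div_le_div_of_nonneg_right ?_ (by positivity)
  calc (θ * x) ^ (2 * (k + 1)) = θ ^ 2 * (θ ^ 2) ^ k * (x ^ 2) ^ (k + 1) := by
        rw [pow_mul, mul_pow, mul_pow]; ring
    _ ≤ θ ^ 2 * 1 * (x ^ 2) ^ (k + 1) := by
        gcongr
        exact pow_le_one₀ (sq_nonneg θ) h1
    _ = θ ^ 2 * x ^ (2 * (k + 1)) := by rw [pow_mul]; ring

theorem hasSum_exp_neg_abs (l t : ℝ) (h1 : t < l) (h2 : -t < l) :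
    HasSum (fun k : ℤ => Real.exp (-(l * |(k : ℝ)|) + t * k))
      ((1 - Real.exp (-l) ^ 2) / ((1 - Real.exp (t - l)) * (1 - Real.exp (-t - l)))) := by
  have ha : Real.exp (t - l) < 1 := by rw [Real.exp_lt_one_iff]; linarith
  have hb : Real.exp (-t - l) < 1 := by rw [Real.exp_lt_one_iff]; linarith
  have hA := hasSum_geometric_of_lt_one (Real.exp_pos (t - l)).le ha
  have hB := (hasSum_geometric_of_lt_one (Real.exp_pos (-t - l)).le hb).mul_left
    (Real.exp (-t - l))
  have key : HasSum (fun k : ℤ => Real.exp (-(l * |(k : ℝ)|) + t * k)) _ :=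
    HasSum.of_nat_of_neg_add_one (f := fun k : ℤ => Real.exp (-(l * |(k : ℝ)|) + t * k))
      (m := (1 - Real.exp (t - l))⁻¹)
      (m' := Real.exp (-t - l) * (1 - Real.exp (-t - l))⁻¹) ?_ ?_
  · convert! key using 1
    have hq : Real.exp (-l) ^ 2 = Real.exp (t - l) * Real.exp (-t - l) := by
      rw [← Real.exp_nat_mul, ← Real.exp_add]; congr 1; push_cast; ring
    have ha' : 1 - Real.exp (t - l) ≠ 0 := by linarith
    have hb' : 1 - Real.exp (-t - l) ≠ 0 := by linarith
    rw [hq]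
    field_simp
    ring
  · convert! hA using 2 with k
    rw [← Real.exp_nat_mul]
    congr 1
    rw [Int.cast_natCast, abs_of_nonneg (Nat.cast_nonneg k)]
    ring
  · convert! hB using 2 with k
    rw [← Real.exp_nat_mul, ← Real.exp_add]
    congr 1
    push_cast
    rw [abs_of_nonpos (by have : (0 : ℝ) ≤ k := Nat.cast_nonneg k
                          linarith)]
    ring

/-- With `q = exp (-l)`, both sums are explicit, and their ratio is `(1 - q)² / (1 - 2 q cosh (θ l)
+ q²)`. Since `(1 - q)² = 2 q (cosh l - 1)`, the `cosh` estimate bounds the denominator below by `(1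
- θ²) (1 - q)²`, uniformly in `l`. -/
theorem tsum_exp_neg_abs_le {l θ : ℝ} (hl : 0 < l) (hθ : |θ| ≤ 1 / 2) :
    ∑' k : ℤ, ENNReal.ofReal (Real.exp (-(l * |(k : ℝ)|) + θ * l * k)) ≤
      ENNReal.ofReal (Real.exp (2 * θ ^ 2)) *
        ∑' k : ℤ, ENNReal.ofReal (Real.exp (-(l * |(k : ℝ)|))) := by
  obtain ⟨hθ1, hθ2⟩ := abs_le.1 hθ
  have hs := hasSum_exp_neg_abs l (θ * l) (by nlinarith) (by nlinarith)
  have hs0 := hasSum_exp_neg_abs l 0 hl (by simpa using hl)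
  simp only [zero_mul, add_zero, zero_sub, neg_zero] at hs0
  rw [← ENNReal.ofReal_tsum_of_nonneg (fun _ => (Real.exp_pos _).le) hs.summable,
    ← ENNReal.ofReal_tsum_of_nonneg (fun _ => (Real.exp_pos _).le) hs0.summable,
    hs.tsum_eq, hs0.tsum_eq, ← ENNReal.ofReal_mul (Real.exp_pos _).le]
  refine ENNReal.ofReal_le_ofReal ?_
  have hq : Real.exp (-l) < 1 := by rw [Real.exp_lt_one_iff]; linarith
  have hq0 := Real.exp_pos (-l)
  have ha : Real.exp (θ * l - l) < 1 := by rw [Real.exp_lt_one_iff]; nlinarith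
  have hb : Real.exp (-(θ * l) - l) < 1 := by rw [Real.exp_lt_one_iff]; nlinarith
  have hcosh := cosh_mul_sub_one_le θ l (hθ.trans (by norm_num))
  have hprod : (1 - Real.exp (θ * l - l)) * (1 - Real.exp (-(θ * l) - l)) =
      1 - 2 * Real.exp (-l) * Real.cosh (θ * l) + Real.exp (-l) ^ 2 := by
    rw [Real.cosh_eq, show θ * l - l = θ * l + -l by ring,
      show -(θ * l) - l = -(θ * l) + -l by ring, Real.exp_add, Real.exp_add]
    have : Real.exp (θ * l) * Real.exp (-(θ * l)) = 1 := by rw [← Real.exp_add]; simp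
    linear_combination (Real.exp (-l) ^ 2) * this
  have hsq : 2 * Real.exp (-l) * Real.cosh l = 1 + Real.exp (-l) ^ 2 := by
    have : Real.exp l * Real.exp (-l) = 1 := by rw [← Real.exp_add]; simp
    rw [Real.cosh_eq]
    linear_combination this
  have hmain : (1 - Real.exp (-l)) * (1 - Real.exp (-l)) ≤ Real.exp (2 * θ ^ 2) *
      ((1 - Real.exp (θ * l - l)) * (1 - Real.exp (-(θ * l) - l))) := by
    have h1 : (1 - θ ^ 2) * (1 - Real.exp (-l)) ^ 2 ≤
        (1 - Real.exp (θ * l - l)) * (1 - Real.exp (-(θ * l) - l)) := by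
      rw [hprod]
      nlinarith
    have h2 : 1 + 2 * θ ^ 2 ≤ Real.exp (2 * θ ^ 2) := by
      linarith [Real.add_one_le_exp (2 * θ ^ 2)]
    have h3 : θ ^ 2 ≤ 1 / 4 := by nlinarith
    have h4 : 1 ≤ (1 + 2 * θ ^ 2) * (1 - θ ^ 2) := by nlinarith [sq_nonneg θ]
    calc (1 - Real.exp (-l)) * (1 - Real.exp (-l)) = 1 * (1 - Real.exp (-l)) ^ 2 := by ring
      _ ≤ ((1 + 2 * θ ^ 2) * (1 - θ ^ 2)) * (1 - Real.exp (-l)) ^ 2 := by gcongr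
      _ = (1 + 2 * θ ^ 2) * ((1 - θ ^ 2) * (1 - Real.exp (-l)) ^ 2) := by ring
      _ ≤ _ := mul_le_mul h2 h1 (mul_nonneg (by linarith) (sq_nonneg _)) (Real.exp_pos _).le
  rw [← mul_div_assoc]
  rw [div_le_div_iff₀ (mul_pos (by linarith) (by linarith)) (mul_pos (by linarith) (by linarith))]
  have hq2 : 0 ≤ 1 - Real.exp (-l) ^ 2 := by nlinarith
  calc _ ≤ (1 - Real.exp (-l) ^ 2) * (Real.exp (2 * θ ^ 2) *
      ((1 - Real.exp (θ * l - l)) * (1 - Real.exp (-(θ * l) - l)))) := by gcongr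
    _ = _ := by ring

theorem tsum_prod_fin (m : ℕ) (g : Fin m → ℤ → ENNReal) :
    ∑' x : Fin m → ℤ, ∏ i, g i (x i) = ∏ i, ∑' k, g i k := by
  induction m with
  | zero => simp [tsum_fintype]
  | succ m ih =>
    rw [← (Fin.consEquiv fun _ => ℤ).tsum_eq, ENNReal.tsum_prod', Fin.prod_univ_succ, ← ih]
    simp [Fin.consEquiv, Fin.prod_univ_succ, ENNReal.tsum_mul_left, ENNReal.tsum_mul_right]

theorem tsum_prod_fintype {ι : Type*} [Fintype ι] (g : ι → ℤ → ENNReal) :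
    ∑' x : ι → ℤ, ∏ i, g i (x i) = ∏ i, ∑' k, g i k := by
  let e := Fintype.equivFin ι
  rw [← e.symm.prod_comp, ← tsum_prod_fin, ← (e.arrowCongr (Equiv.refl ℤ)).tsum_eq]
  refine tsum_congr fun x => ?_
  rw [← e.symm.prod_comp]
  simp

theorem tsum_exp_neg_abs_ne_top {l : ℝ} (hl : 0 < l) :
    ∑' k : ℤ, ENNReal.ofReal (Real.exp (-(l * |(k : ℝ)|))) ≠ ⊤ := by
  have hs0 := hasSum_exp_neg_abs l 0 hl (by simpa using hl)
  simp only [zero_mul, add_zero] at hs0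
  rw [← ENNReal.ofReal_tsum_of_nonneg (fun _ => (Real.exp_pos _).le) hs0.summable]
  exact ENNReal.ofReal_ne_top

theorem tsum_exp_neg_abs_ne_zero (l : ℝ) :
    ∑' k : ℤ, ENNReal.ofReal (Real.exp (-(l * |(k : ℝ)|))) ≠ 0 := by
  intro h
  have := ENNReal.tsum_eq_zero.1 h 0
  simp at this

/-- The discrete Laplace distribution, with weights proportional to `exp (-l * |k|)`. -/
noncomputable def discreteLaplace (l : ℝ) (hl : 0 < l) : PMF ℤ :=
  PMF.normalize (fun k : ℤ => ENNReal.ofReal (Real.exp (-(l * |(k : ℝ)|))))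
    (tsum_exp_neg_abs_ne_zero l) (tsum_exp_neg_abs_ne_top hl)

theorem discreteLaplace_le {l : ℝ} (hl : 0 < l) (j k : ℤ) :
    discreteLaplace l hl j ≤
      ENNReal.ofReal (Real.exp (l * |(j : ℝ) - k|)) * discreteLaplace l hl k := by
  rw [discreteLaplace, PMF.normalize_apply, PMF.normalize_apply, ← mul_assoc,
    ← ENNReal.ofReal_mul (Real.exp_pos _).le, ← Real.exp_add]
  gcongr
  have := abs_sub_abs_le_abs_sub (k : ℝ) j
  rw [abs_sub_comm (k : ℝ)] at this
  nlinarith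

theorem discreteLaplace_mgf_le {l θ : ℝ} (hl : 0 < l) (hθ : |θ| ≤ 1 / 2) :
    ∑' k : ℤ, discreteLaplace l hl k * ENNReal.ofReal (Real.exp (θ * l * k)) ≤
      ENNReal.ofReal (Real.exp (2 * θ ^ 2)) := by
  have h : ∀ k : ℤ, discreteLaplace l hl k * ENNReal.ofReal (Real.exp (θ * l * k)) =
      ENNReal.ofReal (Real.exp (-(l * |(k : ℝ)|) + θ * l * k)) *
        (∑' k : ℤ, ENNReal.ofReal (Real.exp (-(l * |(k : ℝ)|))))⁻¹ := by
    intro k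
    rw [discreteLaplace, PMF.normalize_apply, Real.exp_add,
      ENNReal.ofReal_mul (Real.exp_pos _).le]
    ring
  simp_rw [h]
  rw [ENNReal.tsum_mul_right, ← div_eq_mul_inv]
  exact ENNReal.div_le_of_le_mul (tsum_exp_neg_abs_le hl hθ)

/-- Independent discrete Laplace variables. -/
noncomputable def laplaceNoise (ι : Type*) [Fintype ι] (l : ℝ) (hl : 0 < l) : PMF (ι → ℤ) :=
  ⟨fun x => ∏ i, discreteLaplace l hl (x i), by
    have h := tsum_prod_fintype (ι := ι) fun _ => discreteLaplace l hl
    simp only [PMF.tsum_coe, Finset.prod_const_one] at h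
    exact h ▸ ENNReal.summable.hasSum⟩

theorem laplaceNoise_apply {ι : Type*} [Fintype ι] {l : ℝ} (hl : 0 < l) (x : ι → ℤ) :
    laplaceNoise ι l hl x = ∏ i, discreteLaplace l hl (x i) := rfl

theorem laplaceNoise_le {ι : Type*} [Fintype ι] {l : ℝ} (hl : 0 < l) (x y : ι → ℤ) :
    laplaceNoise ι l hl x ≤
      ENNReal.ofReal (Real.exp (l * ∑ i, |(x i : ℝ) - y i|)) * laplaceNoise ι l hl y := by
  rw [laplaceNoise_apply, laplaceNoise_apply, Finset.mul_sum, Real.exp_sum,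
    ENNReal.ofReal_prod_of_nonneg (fun _ _ => (Real.exp_pos _).le), ← Finset.prod_mul_distrib]
  exact Finset.prod_le_prod' fun i _ => discreteLaplace_le hl _ _

theorem toOuterMeasure_map_add_le {ι : Type*} [Fintype ι] {l : ℝ} (hl : 0 < l) (j k : ι → ℤ)
    (s : Set (ι → ℤ)) :
    ((laplaceNoise ι l hl).map (j + ·)).toOuterMeasure s ≤
      ENNReal.ofReal (Real.exp (l * ∑ i, |(j i : ℝ) - k i|)) *
        ((laplaceNoise ι l hl).map (k + ·)).toOuterMeasure s := by
  have h : ∀ j : ι → ℤ, ((laplaceNoise ι l hl).map (j + ·)).toOuterMeasure s =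
      ∑' y, s.indicator (fun y => laplaceNoise ι l hl (y - j)) y := by
    intro j
    rw [PMF.toOuterMeasure_map_apply, PMF.toOuterMeasure_apply,
      ← (Equiv.addLeft j).tsum_eq (s.indicator _)]
    refine tsum_congr fun x => ?_
    by_cases h : j + x ∈ s <;> simp [h, Set.indicator]
  rw [h, h, ← ENNReal.tsum_mul_left]
  refine ENNReal.tsum_le_tsum fun y => ?_
  by_cases hy : y ∈ s
  · rw [Set.indicator_of_mem hy, Set.indicator_of_mem hy]
    refine (laplaceNoise_le hl (y - j) (y - k)).trans_eq ?_
    congr 4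
    refine Finset.sum_congr rfl fun i _ => ?_
    rw [abs_sub_comm]
    congr 1
    simp
  · simp [hy]

/-- Exponential Markov inequality: the moment generating function factors over the coordinates, each
one in `A` contributing at most `exp (2 θ²)`. Both signs of `θ` are allowed, to cover both tails. -/
theorem laplaceNoise_sum_ge_le {ι : Type*} [Fintype ι] {l θ σ : ℝ} (hl : 0 < l)
    (hθ : |θ| ≤ 1 / 2) (A : Finset ι) (τ : ℝ) (hσ : σ = θ * l) :
    (laplaceNoise ι l hl).toOuterMeasure {x | τ ≤ σ * ∑ i ∈ A, (x i : ℝ)} ≤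
      ENNReal.ofReal (Real.exp (2 * A.card * θ ^ 2 - τ)) := by
  classical
  subst hσ
  have hpt : ∀ x : ι → ℤ, {x : ι → ℤ | τ ≤ θ * l * ∑ i ∈ A, (x i : ℝ)}.indicator
      (laplaceNoise ι l hl) x ≤ ENNReal.ofReal (Real.exp (-τ)) *
        ∏ i, (discreteLaplace l hl (x i) *
          if i ∈ A then ENNReal.ofReal (Real.exp (θ * l * x i)) else 1) := by
    intro x
    rw [Finset.prod_mul_distrib, ← laplaceNoise_apply, Finset.prod_ite_mem,
      Finset.univ_inter, ← ENNReal.ofReal_prod_of_nonneg (fun _ _ => (Real.exp_pos _).le),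
      ← Real.exp_sum, mul_left_comm, ← ENNReal.ofReal_mul (Real.exp_pos _).le, ← Real.exp_add,
      ← Finset.mul_sum]
    refine Set.indicator_apply_le' (fun hx => ?_) fun _ => zero_le
    have hx : τ ≤ θ * l * ∑ i ∈ A, (x i : ℝ) := hx
    refine le_mul_of_one_le_right' ?_
    rw [← ENNReal.ofReal_one]
    exact ENNReal.ofReal_le_ofReal (Real.one_le_exp (by linarith))
  rw [PMF.toOuterMeasure_apply]
  refine (ENNReal.tsum_le_tsum hpt).trans ?_
  rw [ENNReal.tsum_mul_left, tsum_prod_fintype (fun i k => discreteLaplace l hl k *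
    if i ∈ A then ENNReal.ofReal (Real.exp (θ * l * k)) else 1)]
  have hfac : ∀ i, (∑' k, discreteLaplace l hl k *
      if i ∈ A then ENNReal.ofReal (Real.exp (θ * l * k)) else 1) ≤
        if i ∈ A then ENNReal.ofReal (Real.exp (2 * θ ^ 2)) else 1 := by
    intro i
    by_cases hi : i ∈ A
    · simpa only [hi, if_true] using discreteLaplace_mgf_le hl hθ
    · simp [hi]
  calc _ ≤ ENNReal.ofReal (Real.exp (-τ)) *
        ∏ i, if i ∈ A then ENNReal.ofReal (Real.exp (2 * θ ^ 2)) else 1 := by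
        gcongr with i
        exact hfac i
    _ = _ := by
        rw [Finset.prod_ite_mem, Finset.univ_inter, Finset.prod_const,
          ← ENNReal.ofReal_pow (Real.exp_pos _).le, ← Real.exp_nat_mul,
          ← ENNReal.ofReal_mul (Real.exp_pos _).le, ← Real.exp_add]
        congr 2
        ring

/-- Tail bound for sums of independent discrete Laplace variables. -/
theorem laplaceNoise_abs_sum_gt_le {ι : Type*} [Fintype ι] {l θ : ℝ} (hl : 0 < l) (hθ0 : 0 ≤ θ)
    (hθ : θ ≤ 1 / 2) (A : Finset ι) (τ : ℝ) :
    (laplaceNoise ι l hl).toOuterMeasure {x | τ / l < |∑ i ∈ A, (x i : ℝ)|} ≤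
      ENNReal.ofReal (2 * Real.exp (2 * A.card * θ ^ 2 - θ * τ)) := by
  have hsub : {x : ι → ℤ | τ / l < |∑ i ∈ A, (x i : ℝ)|} ⊆
      {x | θ * τ ≤ (θ * l) * ∑ i ∈ A, (x i : ℝ)} ∪
        {x | θ * τ ≤ (-θ * l) * ∑ i ∈ A, (x i : ℝ)} := by
    intro x hx
    have hx : τ / l < |∑ i ∈ A, (x i : ℝ)| := hx
    rw [div_lt_iff₀ hl, mul_comm] at hx
    rcases abs_cases (∑ i ∈ A, (x i : ℝ)) with ⟨h, -⟩ | ⟨h, -⟩ <;> rw [h] at hx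
    · refine Or.inl (?_ : θ * τ ≤ _)
      rw [mul_assoc]
      gcongr
    · refine Or.inr (?_ : θ * τ ≤ _)
      calc θ * τ ≤ θ * (l * -∑ i ∈ A, (x i : ℝ)) := by gcongr
        _ = _ := by ring
  have h1 := laplaceNoise_sum_ge_le hl (by rwa [abs_of_nonneg hθ0]) A (θ * τ) rfl
  have h2 := laplaceNoise_sum_ge_le hl (by rwa [abs_neg, abs_of_nonneg hθ0]) A (θ * τ)
    (rfl : -θ * l = -θ * l)
  rw [neg_sq] at h2
  refine ((laplaceNoise ι l hl).toOuterMeasure.mono hsub).trans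
    ((MeasureTheory.measure_union_le _ _).trans ((add_le_add h1 h2).trans_eq ?_))
  rw [two_mul (Real.exp _), ENNReal.ofReal_add (Real.exp_pos _).le (Real.exp_pos _).le]

/-! ### The Laplace mechanism: privacy and accuracy -/

/-- The graph without edges. -/
def emptyWGraph (n : ℕ) : WGraph n where
  w _ _ := 0
  symm _ _ := rfl
  nonneg _ _ := le_rfl
  loopless _ := rfl

/-- The edge weights in units of `1 / N`, rounded down. -/
noncomputable def roundedWeights {n : ℕ} (N : ℝ) (G : WGraph n) (i : Fin n × Fin n) : ℤ :=
  ⌊G.w i.1 i.2 * N⌋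

/-- The value of the cut `(S, Sᶜ)` read off from the integral weights `Y`, in units of `1 / N`. -/
noncomputable def integralCut {n : ℕ} (N : ℝ) (Y : Fin n × Fin n → ℤ) (S : Finset (Fin n)) : ℝ :=
  (∑ i ∈ S ×ˢ Sᶜ, (Y i : ℝ)) / N

open Classical in
/-- A graph whose cuts agree with those of `Y` up to `τ * |S|`, if there is one. -/
noncomputable def fitGraph {n : ℕ} (N τ : ℝ) (Y : Fin n × Fin n → ℤ) : WGraph n :=
  if h : ∃ G : WGraph n, ∀ S, |cut G S - integralCut N Y S| ≤ τ * S.card then h.choose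
  else emptyWGraph n

/-- The input itself witnesses that a fit exists. Input and fit are both within `τ * |S|` of the
noisy cut, hence the factor `2`. -/
theorem abs_cut_sub_cut_fitGraph_le {n : ℕ} {N τ : ℝ} {Y : Fin n × Fin n → ℤ} {G : WGraph n}
    (hG : ∀ S, |cut G S - integralCut N Y S| ≤ τ * S.card) (S : Finset (Fin n)) :
    |cut G S - cut (fitGraph N τ Y) S| ≤ 2 * τ * S.card := by
  have h : ∃ G : WGraph n, ∀ S, |cut G S - integralCut N Y S| ≤ τ * S.card := ⟨G, hG⟩
  have h1 := h.choose_spec S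
  rw [show h.choose = fitGraph N τ Y by rw [fitGraph, dif_pos h]] at h1
  have h2 := hG S
  rw [abs_le] at *
  constructor <;> linarith

/-- The Laplace mechanism: round, add noise, and fit a graph to the noisy cuts. -/
noncomputable def laplaceRelease {n : ℕ} (N l τ : ℝ) (hl : 0 < l) (G : WGraph n) :
    PMF (WGraph n) :=
  ((laplaceNoise (Fin n × Fin n) l hl).map (roundedWeights N G + ·)).map (fitGraph N τ)

theorem sum_abs_roundedWeights_sub_le {n : ℕ} {N : ℝ} (hN : 0 ≤ N) {G G' : WGraph n}
    (h : Adjacent G G') :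
    ∑ i, |(roundedWeights N G' i : ℝ) - roundedWeights N G i| ≤ N + (n : ℝ) ^ 2 := by
  -- Rounding can add up to one unit in each of the `n²` entries.
  have hpt : ∀ i : Fin n × Fin n, |(roundedWeights N G' i : ℝ) - roundedWeights N G i| ≤
      N * |G.w i.1 i.2 - G'.w i.1 i.2| + 1 := by
    intro i
    have hx := Int.floor_le (G.w i.1 i.2 * N)
    have hx' := Int.lt_floor_add_one (G.w i.1 i.2 * N)
    have hy := Int.floor_le (G'.w i.1 i.2 * N)
    have hy' := Int.lt_floor_add_one (G'.w i.1 i.2 * N)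
    have h1 : N * |G.w i.1 i.2 - G'.w i.1 i.2| = |G.w i.1 i.2 * N - G'.w i.1 i.2 * N| := by
      rw [← sub_mul, abs_mul, abs_of_nonneg hN, mul_comm]
    have h2 := le_abs_self (G.w i.1 i.2 * N - G'.w i.1 i.2 * N)
    have h3 := neg_abs_le (G.w i.1 i.2 * N - G'.w i.1 i.2 * N)
    rw [h1, abs_le, roundedWeights, roundedWeights]
    constructor <;> linarith
  refine (Finset.sum_le_sum fun i _ => hpt i).trans ?_
  rw [Finset.sum_add_distrib, ← Finset.mul_sum, Fintype.sum_prod_type]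
  have : N * ∑ u, ∑ v, |G.w u v - G'.w u v| ≤ N * 1 := mul_le_mul_of_nonneg_left h hN
  simp only [Finset.sum_const, Finset.card_univ, Fintype.card_prod, Fintype.card_fin, nsmul_eq_mul]
  push_cast
  nlinarith

theorem isEdgeDP_laplaceRelease {n : ℕ} {N l τ ε δ : ℝ} (hN : 0 ≤ N) (hl : 0 < l) (hδ : 0 ≤ δ)
    (hε : l * (N + (n : ℝ) ^ 2) ≤ ε) :
    IsEdgeDP ε δ (laplaceRelease (n := n) N l τ hl) := by
  rw [isEdgeDP_iff hδ]
  intro G G' h s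
  rw [laplaceRelease, laplaceRelease, PMF.toOuterMeasure_map_apply _ _ s,
    PMF.toOuterMeasure_map_apply _ _ s]
  refine ((toOuterMeasure_map_add_le hl _ (roundedWeights N G) _).trans ?_).trans le_self_add
  gcongr
  exact (mul_le_mul_of_nonneg_left (sum_abs_roundedWeights_sub_le hN h) hl.le).trans hε

/-- The cut has at most `n * |S|` ordered pairs, each with rounding error at most one unit; the
noise contributes the rest. -/
theorem abs_cut_sub_integralCut_le {n : ℕ} {N : ℝ} (hN : 0 < N) (G : WGraph n)
    (x : Fin n × Fin n → ℤ) {r : ℝ} (S : Finset (Fin n))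
    (hx : |∑ i ∈ S ×ˢ Sᶜ, (x i : ℝ)| ≤ r * S.card) :
    |cut G S - integralCut N (roundedWeights N G + x) S| ≤ (n + r) / N * S.card := by
  have h1 : (cut G S - integralCut N (roundedWeights N G + x) S) * N =
      ∑ i ∈ S ×ˢ Sᶜ, (G.w i.1 i.2 * N - roundedWeights N G i) - ∑ i ∈ S ×ˢ Sᶜ, (x i : ℝ) := by
    rw [sub_mul, integralCut, div_mul_cancel₀ _ hN.ne', cut, Finset.sum_sub_distrib,
      ← Finset.sum_mul, ← Finset.sum_product' S Sᶜ G.w]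
    simp only [Pi.add_apply, Int.cast_add, Finset.sum_add_distrib]
    ring
  have h2 : |∑ i ∈ S ×ˢ Sᶜ, (G.w i.1 i.2 * N - roundedWeights N G i)| ≤ n * S.card := by
    have hpt : ∀ i ∈ S ×ˢ Sᶜ, |G.w i.1 i.2 * N - roundedWeights N G i| ≤ 1 := by
      intro i _
      have hx := Int.floor_le (G.w i.1 i.2 * N)
      have hx' := Int.lt_floor_add_one (G.w i.1 i.2 * N)
      rw [abs_le, roundedWeights]
      constructor <;> linarith
    refine (Finset.abs_sum_le_sum_abs _ _).trans ((Finset.sum_le_sum hpt).trans ?_)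
    rw [Finset.sum_const, Finset.card_product, nsmul_eq_mul, mul_one, mul_comm, Nat.cast_mul]
    gcongr
    exact (Finset.card_le_univ Sᶜ).trans_eq (Fintype.card_fin n)
  rw [div_mul_eq_mul_div, le_div_iff₀ hN]
  calc _ = |(cut G S - integralCut N (roundedWeights N G + x) S) * N| := by
        rw [abs_mul, abs_of_pos hN]
    _ ≤ _ := by
        rw [h1]
        refine (abs_sub _ _).trans ((add_le_add h2 hx).trans_eq ?_)
        ring

/-- With `x = n⁻⁶`, the sum of `x ^ |S|` over all `S` is `(1 + x) ^ n ≤ exp (n x)`, and `n x ≤ 1 /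
32`; the empty set accounts for the `1` to be removed. -/
theorem sum_pow_card_erase_le {n : ℕ} (hn : 2 ≤ n) :
    ∑ S ∈ (Finset.univ : Finset (Finset (Fin n))).erase ∅,
      2 * Real.exp (-(6 * Real.log n)) ^ S.card ≤ 1 / 5 := by
  have hn2 : (2 : ℝ) ≤ n := by exact_mod_cast hn
  have hx : Real.exp (-(6 * Real.log n)) = ((n : ℝ) ^ 6)⁻¹ := by
    rw [Real.exp_neg, mul_comm, Real.exp_mul, Real.exp_log (by linarith)]
    norm_cast
  set x := Real.exp (-(6 * Real.log n)) with hxdef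
  have hx0 : 0 < x := Real.exp_pos _
  have hsum := Fintype.sum_pow_mul_eq_add_pow (Fin n) x 1
  simp only [one_pow, mul_one, Fintype.card_fin] at hsum
  rw [← Finset.mul_sum]
  have herase := Finset.add_sum_erase Finset.univ (fun S : Finset (Fin n) => x ^ S.card)
    (Finset.mem_univ ∅)
  rw [hsum, Finset.card_empty, pow_zero] at herase
  have hnx : (n : ℝ) * x ≤ 1 / 32 := by
    rw [hx, mul_inv_le_iff₀ (by positivity)]
    have : (2 : ℝ) ^ 5 ≤ (n : ℝ) ^ 5 := by gcongr
    nlinarith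
  have h1 : (x + 1) ^ n ≤ Real.exp (1 / 32) := by
    calc (x + 1) ^ n ≤ Real.exp x ^ n := by gcongr; exact Real.add_one_le_exp x
      _ = Real.exp (n * x) := (Real.exp_nat_mul x n).symm
      _ ≤ _ := Real.exp_le_exp.2 hnx
  have h2 : Real.exp (1 / 32) ≤ 32 / 31 := by
    have h3 := Real.add_one_le_exp (-(1 / 32) : ℝ)
    have h4 : Real.exp (1 / 32) * Real.exp (-(1 / 32)) = 1 := by rw [← Real.exp_add]; simp
    nlinarith [Real.exp_pos (1 / 32)]
  linarith

/-- With probability at least `4 / 5`, the noise on all cuts is small. -/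
theorem four_fifths_le_prob_noise {n : ℕ} (hn : 2 ≤ n) {l : ℝ} (hl : 0 < l) :
    4 / 5 ≤ prob (laplaceNoise (Fin n × Fin n) l hl)
      {x | ∀ S : Finset (Fin n), |∑ i ∈ S ×ˢ Sᶜ, (x i : ℝ)| ≤
        (Real.sqrt n * (1 + 12 * Real.log n) / l) * S.card} := by
  have hn2 : (2 : ℝ) ≤ n := by exact_mod_cast hn
  set T := Real.sqrt n * (1 + 12 * Real.log n)
  have hsq : Real.sqrt n ^ 2 = n := Real.sq_sqrt (by linarith)
  have hs1 : 1 ≤ Real.sqrt n := Real.one_le_sqrt.2 (by linarith)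
  -- This `θ` makes the variance term `2 |S| |Sᶜ| θ²` at most `|S| / 2`; the `1` in `T` cancels it,
  -- and the `12 log n` leaves the exponent `-6 |S| log n`.
  set θ := 1 / (2 * Real.sqrt n) with hθdef
  have hθ0 : 0 ≤ θ := by positivity
  have hθ : θ ≤ 1 / 2 := by
    rw [hθdef, div_le_div_iff₀ (by positivity) (by norm_num)]
    linarith
  have hθ2 : 2 * n * θ ^ 2 = 1 / 2 := by
    rw [hθdef, ← hsq]
    field_simp
    norm_num
  have hθT : θ * T = 1 / 2 + 6 * Real.log n := by
    simp only [T, hθdef]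
    field_simp
    ring
  rw [show (4 / 5 : ℝ) = 1 - 1 / 5 by norm_num]
  refine le_prob_of_compl_le _ _ ?_
  have hsub : {x : Fin n × Fin n → ℤ | ∀ S : Finset (Fin n), |∑ i ∈ S ×ˢ Sᶜ, (x i : ℝ)| ≤
        (T / l) * S.card}ᶜ ⊆
      ⋃ S ∈ (Finset.univ : Finset (Finset (Fin n))).erase ∅,
        {x | (T * S.card) / l < |∑ i ∈ S ×ˢ Sᶜ, (x i : ℝ)|} := by
    intro x hx
    simp only [Set.mem_compl_iff, Set.mem_ofPred_eq, not_forall, not_le] at hx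
    obtain ⟨S, hS⟩ := hx
    simp only [Set.mem_iUnion, Set.mem_ofPred_eq]
    refine ⟨S, Finset.mem_erase.2 ⟨?_, Finset.mem_univ _⟩, by rwa [mul_div_right_comm]⟩
    rintro rfl
    simp at hS
  have hS : ∀ S : Finset (Fin n), (laplaceNoise (Fin n × Fin n) l hl).toOuterMeasure
      {x | (T * S.card) / l < |∑ i ∈ S ×ˢ Sᶜ, (x i : ℝ)|} ≤
        ENNReal.ofReal (2 * Real.exp (-(6 * Real.log n)) ^ S.card) := by
    intro S
    refine (laplaceNoise_abs_sum_gt_le hl hθ0 hθ _ _).trans (ENNReal.ofReal_le_ofReal ?_)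
    rw [← Real.exp_nat_mul]
    gcongr
    have hc : (Sᶜ.card : ℝ) ≤ n := by
      exact_mod_cast (Finset.card_le_univ Sᶜ).trans_eq (Fintype.card_fin n)
    have h1 : (2 * ((S ×ˢ Sᶜ).card : ℝ)) * θ ^ 2 ≤ S.card * (2 * n * θ ^ 2) := by
      rw [Finset.card_product, Nat.cast_mul]
      calc _ = (S.card : ℝ) * (2 * Sᶜ.card * θ ^ 2) := by ring
        _ ≤ _ := by gcongr
    rw [hθ2] at h1
    have h2 : θ * (T * S.card) = S.card * (1 / 2 + 6 * Real.log n) := by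
      rw [← hθT]; ring
    rw [h2]
    linarith
  have hle := ((laplaceNoise (Fin n × Fin n) l hl).toOuterMeasure.mono hsub).trans
    ((MeasureTheory.measure_biUnion_finset_le _ _).trans (Finset.sum_le_sum fun S _ => hS S))
  rw [← ENNReal.ofReal_sum_of_nonneg (fun S _ => by positivity)] at hle
  exact (ENNReal.toReal_le_of_le_ofReal (Finset.sum_nonneg fun S _ => by positivity) hle).trans
    (sum_pow_card_erase_le hn)

theorem four_fifths_le_prob_laplaceRelease {n : ℕ} (hn : 2 ≤ n) {N l τ : ℝ} (hN : 0 < N)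
    (hl : 0 < l) (hτ : τ = (n + Real.sqrt n * (1 + 12 * Real.log n) / l) / N) (G : WGraph n) :
    4 / 5 ≤ prob (laplaceRelease N l τ hl G)
      {G' | ∀ S, |cut G S - cut G' S| ≤ 2 * τ * S.card} := by
  subst hτ
  refine (four_fifths_le_prob_noise hn hl).trans ?_
  rw [laplaceRelease, prob, prob, PMF.toOuterMeasure_map_apply, PMF.toOuterMeasure_map_apply]
  exact prob_mono _ fun x hx S =>
    abs_cut_sub_cut_fitGraph_le (fun S => abs_cut_sub_integralCut_le hN G x S (hx S)) S

/-! ### Choice of parameters and final estimates -/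

theorem half_le_log {n : ℕ} (hn : 2 ≤ n) : 1 / 2 ≤ Real.log n := by
  have h : Real.log 2 ≤ Real.log n := Real.log_le_log (by norm_num) (by exact_mod_cast hn)
  linarith [Real.log_two_gt_d9]

theorem cutError_nonneg {C ε δ : ℝ} (hC : 0 ≤ C) (hε : 0 < ε) (n : ℕ) :
    0 ≤ cutError C ε δ n :=
  mul_nonneg (mul_nonneg hC (by positivity))
    (div_nonneg (Real.log_natCast_nonneg n) (Real.sqrt_nonneg _))

theorem natCast_mul_cutError {C ε δ : ℝ} {n : ℕ} (hn : 1 ≤ n) :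
    (n : ℝ) * cutError C ε δ n =
      C * (Real.sqrt n * Real.log n * Real.log (1 / δ) ^ 2 / ε) := by
  have h0 : (0 : ℝ) < n := by exact_mod_cast hn
  have hsq : Real.sqrt n * Real.sqrt n = n := Real.mul_self_sqrt h0.le
  have hs : Real.sqrt n ≠ 0 := (Real.sqrt_pos.2 h0).ne'
  have h1 : (n : ℝ) * (Real.log n / Real.sqrt n) = Real.sqrt n * Real.log n := by
    rw [← mul_div_assoc, div_eq_iff hs]
    nth_rewrite 1 [← hsq]
    ring
  rw [cutError, mul_left_comm, h1]
  ring

/-- A private release of a graph all of whose cuts are accurate. -/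
theorem exists_private_release {n : ℕ} {ε δ : ℝ} (hn : 1 ≤ n) (hε : 0 < ε) (hδ0 : 0 < δ)
    (hδ1 : δ < 1) : ∃ M : WGraph n → PMF (WGraph n), IsEdgeDP ε δ M ∧ ∀ G : WGraph n,
      4 / 5 ≤ prob (M G) {G' | ∀ S : Finset (Fin n),
        |cut G S - cut G' S| ≤ (n : ℝ) * cutError 1500 ε δ n * S.card} := by
  have hβ : 0 ≤ (n : ℝ) * cutError 1500 ε δ n :=
    mul_nonneg (Nat.cast_nonneg _) (cutError_nonneg (by norm_num) hε n)
  by_cases h45 : 4 / 5 ≤ δ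
  -- Here `log (1 / δ)` may be arbitrarily small, so no noise is affordable; an exact release with
  -- probability `δ` is enough.
  · lift δ to NNReal using hδ0.le
    have hδ1' : δ ≤ 1 := by exact_mod_cast hδ1.le
    refine ⟨releaseOrHide (emptyWGraph n) δ hδ1', isEdgeDP_releaseOrHide _ _ _ hε.le,
      fun G => h45.trans (le_prob_releaseOrHide _ _ _ _ fun S => ?_)⟩
    rw [sub_self, abs_zero]
    positivity
  by_cases hn2 : 2 ≤ n
  · have hnR : (2 : ℝ) ≤ n := by exact_mod_cast hn2
    -- `N ≥ n²` bounds the sensitivity `N + n²` by `2 N`, whence `l = ε / (2 N)`. The factor `max 1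
    -- ε` keeps the rounding error `n / N` below `1 / ε` for large `ε` too.
    set N : ℝ := (n : ℝ) ^ 2 * max 1 ε with hNdef
    have hmax1 : 1 ≤ max 1 ε := le_max_left _ _
    have hN : 0 < N := by positivity
    have hl : 0 < ε / (2 * N) := by positivity
    refine ⟨laplaceRelease N (ε / (2 * N)) _ hl, isEdgeDP_laplaceRelease hN.le hl hδ0.le ?_,
      fun G => (four_fifths_le_prob_laplaceRelease hn2 hN hl rfl G).trans
        (prob_mono _ fun G' hG' S => (hG' S).trans ?_)⟩
    · rw [div_mul_eq_mul_div, div_le_iff₀ (by positivity)]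
      have : (n : ℝ) ^ 2 ≤ N := le_mul_of_one_le_right (by positivity) hmax1
      gcongr
      linarith
    · refine mul_le_mul_of_nonneg_right ?_ (Nat.cast_nonneg _)
      rw [natCast_mul_cutError hn]
      have hlog := half_le_log hn2
      have hs1 : 1 ≤ Real.sqrt n := Real.one_le_sqrt.2 (by linarith)
      have hL : 1 / 5 ≤ Real.log (1 / δ) := by
        have h1 := Real.one_sub_inv_le_log_of_pos (x := 1 / δ) (by positivity)
        rw [one_div, inv_inv] at h1
        rw [one_div δ]
        linarith
      have hL2 : 1 / 25 ≤ Real.log (1 / δ) ^ 2 := by nlinarith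
      have hnN : (n : ℝ) / N ≤ 1 / ε := by
        rw [div_le_div_iff₀ hN hε, one_mul]
        have : ε ≤ max 1 ε := le_max_right _ _
        calc (n : ℝ) * ε ≤ (n : ℝ) ^ 2 * max 1 ε := by
              gcongr
              nlinarith
          _ = N := rfl
      have hT : Real.sqrt n * (1 + 12 * Real.log n) / (ε / (2 * N)) / N =
          2 * (Real.sqrt n * (1 + 12 * Real.log n)) / ε := by
        field_simp
      have hX : 1 / 2 ≤ Real.sqrt n * Real.log n := by nlinarith
      have hsX : Real.sqrt n ≤ 2 * (Real.sqrt n * Real.log n) := by nlinarith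
      calc 2 * ((n + Real.sqrt n * (1 + 12 * Real.log n) / (ε / (2 * N))) / N)
          = 2 * (n / N) + 4 * (Real.sqrt n * (1 + 12 * Real.log n)) / ε := by
            rw [add_div, hT]; ring
        _ ≤ 2 * (1 / ε) + 4 * (Real.sqrt n * (1 + 12 * Real.log n)) / ε := by gcongr
        _ = (2 + 4 * Real.sqrt n + 48 * (Real.sqrt n * Real.log n)) / ε := by ring
        -- `60 = 4 + 8 + 48`, from `1 / 2 ≤ log n`. Next, `1500 = 60 * 25` pays for `log (1 / δ) ^ 2
        -- ≥ 1 / 25`.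
        _ ≤ (60 * (Real.sqrt n * Real.log n)) / ε := by gcongr ?_ / _; linarith
        _ ≤ (1500 * (Real.sqrt n * Real.log n * Real.log (1 / δ) ^ 2)) / ε := by
            gcongr ?_ / _
            nlinarith
        _ = _ := by ring
  -- For `n = 1` the allowed error is zero as `log 1 = 0`, but there is only one graph, so the
  -- identity is private.
  · refine ⟨fun G => PMF.pure G, fun G G' _ s => ?_, fun G => ?_⟩
    · have : G' = G := by
        cases G with
        | mk w _ _ hw =>
        cases G' with
        | mk w' _ _ hw' =>
        congr
        funext u v
        have huv : u = v := Fin.ext (by omega)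
        rw [huv, hw, hw']
      subst this
      have := prob_nonneg (PMF.pure G') s
      nlinarith [Real.one_le_exp hε.le]
    · have hG : G ∈ {G' : WGraph n | ∀ S : Finset (Fin n),
          |cut G S - cut G' S| ≤ (n : ℝ) * cutError 1500 ε δ n * S.card} := by
        intro S
        rw [sub_self, abs_zero]
        positivity
      classical
      rw [prob, PMF.toOuterMeasure_pure_apply, if_pos hG]
      norm_num

theorem expCost_pure {n : ℕ} (G : WGraph n) (T : HCTree n) :
    expCost G (PMF.pure T) = cost G T := by
  classical
  rw [expCost, Finset.sum_eq_single T]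
  · simp
  · intro T' _ h
    simp [PMF.pure_apply, h]
  · simp

theorem rpow_five_halves (x : ℝ) (hx : 0 ≤ x) : x ^ (5 / 2 : ℝ) = x ^ 2 * Real.sqrt x := by
  rw [Real.sqrt_eq_rpow, ← Real.rpow_natCast x 2, ← Real.rpow_add' hx (by norm_num)]
  norm_num

end HC

theorem mainTheorem2 :
    ∃ C : ℝ, 0 < C ∧ ∃ η : ℕ → ℝ, Tendsto η atTop (𝓝 0) ∧
      ∀ (n : ℕ) (ε δ : ℝ), 1 ≤ n → 0 < ε → 0 < δ → δ < 1 →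
        ∃ M : HC.WGraph n → PMF (HC.WGraph n),
          HC.IsEdgeDP ε δ M ∧
          (∀ G : HC.WGraph n,
            (4 / 5 : ℝ) ≤ HC.prob (M G)
              {G' | HC.IsCutApprox (HC.cutError C ε δ n) ((n : ℝ) * HC.cutError C ε δ n) G G'}) ∧
          ∀ (a : ℝ) (A : HC.WGraph n → PMF (HC.HCTree n)), HC.IsApprox a 0 A →
            (HC.IsEdgeDP ε δ (fun G => (M G).bind A) ∧
              HC.IsApproxWithProb (4 / 5) ((1 + η n) * a)
                (C * (a + Real.log n) *
                  ((n : ℝ) ^ (5 / 2 : ℝ) * Real.log n * Real.log (1 / δ) ^ 2 / ε)) M A) ∧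
            ∃ K : HC.WGraph n → PMF (HC.HCTree n),
              HC.IsEdgeDP ε δ (fun G => (M G).bind K) ∧
              HC.IsApproxWithProb (4 / 5) ((1 + η n) * a)
                (C * ((n : ℝ) ^ (5 / 2 : ℝ) * Real.log n ^ 2 * Real.log (1 / δ) ^ 2 / ε)) M K := by
  -- The tree error `1500 * B` enters twice; `6000` is `2 * 1500` doubled once more, to replace a
  -- `1` by `2 * log n`.
  refine ⟨6000, by norm_num, fun _ => 0, tendsto_const_nhds, ?_⟩
  intro n ε δ hn hε hδ0 hδ1
  obtain ⟨M, hM, hacc⟩ := HC.exists_private_release hn hε hδ0 hδ1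
  set B : ℝ := (n : ℝ) ^ (5 / 2 : ℝ) * Real.log n * Real.log (1 / δ) ^ 2 / ε with hB
  have hlog0 := Real.log_natCast_nonneg n
  have hB0 : 0 ≤ B := by positivity
  have hE : (n : ℝ) ^ 2 * ((n : ℝ) * HC.cutError 1500 ε δ n) = 1500 * B := by
    rw [HC.natCast_mul_cutError hn, hB, HC.rpow_five_halves _ (Nat.cast_nonneg n)]
    ring
  have hcost : ∀ G G' : HC.WGraph n, (∀ S : Finset (Fin n),
      |HC.cut G S - HC.cut G' S| ≤ (n : ℝ) * HC.cutError 1500 ε δ n * S.card) →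
      ∀ T, |HC.cost G T - HC.cost G' T| ≤ 1500 * B := fun G G' h T =>
    (HC.abs_cost_sub_cost_le h T).trans_eq hE
  refine ⟨M, hM, fun G => (hacc G).trans (HC.prob_mono _ fun G' hG' => ?_), fun a A hA =>
    ⟨⟨hM.bind hδ0.le A, fun G => (hacc G).trans (HC.prob_mono _ fun G' hG' => ?_)⟩, ?_⟩⟩
  · refine HC.isCutApprox_of_abs_le (HC.cutError_nonneg (by norm_num) hε n) fun S =>
      (hG' S).trans ?_
    gcongr ?_ * _
    rw [HC.natCast_mul_cutError hn, HC.natCast_mul_cutError hn]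
    gcongr
    norm_num
  · have hT := hcost G G' hG'
    have h1 := HC.expCost_le_add hT (A G')
    have h2 := hA G'
    have h3 := HC.optCost_le_add hn hT
    rw [Set.mem_ofPred_eq, add_zero, one_mul]
    by_cases hn2 : 2 ≤ n
    · have ha := hA.one_le hn2
      have hlog := HC.half_le_log hn2
      have h4 : a * HC.optCost G' ≤ a * (HC.optCost G + 1500 * B) := by gcongr
      have h5 : 1500 * (a + 1) * B ≤ 6000 * (a + Real.log n) * B := by
        gcongr ?_ * _
        linarith
      linarith
    -- For `n = 1` nothing is known about the sign of `a`, but all costs and the error vanish.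
    · obtain ⟨T, hT⟩ := HC.exists_cost_eq_optCost hn G
      have hn1 : n = 1 := by omega
      have hB1 : B = 0 := by simp [hB, hn1]
      have h6 : HC.expCost G (A G') = 0 := by
        simp [HC.expCost, HC.cost_eq_zero_of_le_one hn1.le]
      rw [h6, ← hT, HC.cost_eq_zero_of_le_one hn1.le, hB1]
      simp
  -- Post-processing need not be efficient: take an optimal tree of the released graph. The
  -- algorithm `A` serves only to show `optCost G ≤ a * optCost G`.
  · choose best hbest using fun G : HC.WGraph n => HC.exists_cost_eq_optCost hn G
    refine ⟨fun G => PMF.pure (best G), hM.bind hδ0.le _, fun G => (hacc G).trans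
      (HC.prob_mono _ fun G' hG' => ?_)⟩
    have hT := hcost G G' hG'
    have h1 := HC.expCost_le_add hT (PMF.pure (best G'))
    rw [HC.expCost_pure G', hbest] at h1
    have h2 := HC.optCost_le_add hn hT
    have h3 := (HC.le_expCost G (A G)).trans (hA G)
    have h4 : (n : ℝ) ^ (5 / 2 : ℝ) * Real.log n ^ 2 * Real.log (1 / δ) ^ 2 / ε =
        B * Real.log n := by rw [hB]; ring
    rw [Set.mem_ofPred_eq, add_zero, one_mul, h4]
    have h5 : 1500 * B + 1500 * B ≤ 6000 * (B * Real.log n) := by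
      by_cases hn2 : 2 ≤ n
      · nlinarith [HC.half_le_log hn2]
      · have hn1 : n = 1 := by omega
        simp [hB, hn1]
    linarith
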